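/- \textbf{Proposition (robustly stable heavy-ball method).} Let $d\ge 1$ and let $f(x)=\frac12 x^TQx+p^Tx+r$ on $\mathbb R^d$, where $Q\in\mathbb R^{d\times d}$ is symmetric positive definite with smallest eigenvalue $\mu$ and largest eigenvalue $L$, $0<\mu<L$. Let $x_*$ be the minimizer of $f$ and $\kappa=L/\mu$. For parameters $\alpha>0$ and $\beta,\nu\ge 0$, the generalized momentum method (GMM) with gradient errors $w_k\in\mathbb R^d$ is $$y_k=x_k+\nu(x_k-x_{k-1}),\qquad x_{k+1}=x_k-\alpha\big(\nabla f(y_k)+w_k\big)+\beta(x_k-x_{k-1}),\qquad k\ge 0,$$ with initial state $\xi_0=(x_0,x_{-1})$; heavy ball is the case $\nu=0$. Its linear convergence rate is $\rho=\rho(A_Q)$, the spectral radius of the iteration matrix $$A_Q=\begin{bmatrix}(1+\beta)I-\alpha(1+\nu)Q & -\beta I+\alpha\nu Q\\ I&0\end{bmatrix}.$$ Its robustness level $L_{2,*}\in[0,\infty]$ is the infimum of all $\gamma\ge 0$ for which there is a function $H\ge 0$ of the initial state with $H((x_*,x_*))=0$ and $$\sum_{k\ge0}\big(f(x_k)-f(x_*)\big)\le\gamma^2\sum_{k\ge0}\|w_k\|^2+H(\xi_0)$$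 for all initial states $\xi_0$ and all square-summable $(w_k)_{k\ge 0}$. Given an eigenvalue decomposition $Q=U\Lambda U^T$ ($U$ orthogonal, $\Lambda$ diagonal), let $H_\infty=\max_{z\in\mathbb C,\,|z|=1}\|T(zI-A_Q)^{-1}B\|$ (spectral norm), where $B=\begin{bmatrix}-\alpha I\\0\end{bmatrix}$ and $T=\begin{bmatrix}\frac1{\sqrt2}\Lambda^{1/2}U^T&0\end{bmatrix}$. Define $$a(\kappa)=\frac{\sqrt\kappa\,(\sqrt{2\kappa-1}-1)}{\kappa-1}\ \text{ if }\kappa\ge 32,\qquad a(\kappa)=1\ \text{ otherwise}.$$ Then the heavy-ball method with $\alpha=a(\kappa)^2/L$, $\nu=0$, $\beta=\big(1-\frac{a(\kappa)}{\sqrt\kappa}\big)^2$ has the rate $\rho=1-\frac{a(\kappa)}{\sqrt\kappa}\in(0,1)$ and satisfies $$L_{2,*}=H_\infty=\frac1{\sqrt{2\mu}},$$ where $L_{2,*}$ has this value both over all initial states and over those with $x_{-1}=x_0$. This is the best possible robustness level: every GMM with $\alpha>0$, $\beta,\nu\ge0$ and $\rho(A_Q)<1$ has $L_{2,*}\ge\frac1{\sqrt{2\mu}}$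 (for either class of initial states) and $H_\infty\ge\frac1{\sqrt{2\mu}}$. Moreover, $a$ is non-decreasing on $(1,\infty)$, $a(\kappa)>\frac54$ for all $\kappa\ge32$, and, as $\kappa\to\infty$, $a(\kappa)=\sqrt2-\frac1{\sqrt\kappa}+\mathcal O\big(\frac1\kappa\big)$, and therefore $1-\frac{a(\kappa)}{\sqrt\kappa}=1-\frac{\sqrt2}{\sqrt\kappa}+\mathcal O\big(\frac1\kappa\big)$. -/

import Mathlib

open Filter Asymptotics
open scoped ENNReal NNReal Matrix

noncomputable section

namespace GMM

/-- The Euclidean space `ℝ^d`. -/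
abbrev E (d : ℕ) := EuclideanSpace ℝ (Fin d)

/-- The states `ξ_k = (x_k, x_{k-1})` of a momentum method. -/
abbrev State (d : ℕ) := E d × E d

/-- The quadratic `f(x) = (1/2) xᵀ Q x + pᵀ x + r`. -/
def quadratic {d : ℕ} (Q : Matrix (Fin d) (Fin d) ℝ) (p : Fin d → ℝ) (r : ℝ) (x : E d) : ℝ :=
  (1 / 2) * (x.ofLp ⬝ᵥ Q *ᵥ x.ofLp) + p ⬝ᵥ x.ofLp + r

/-- One step `(x_k, x_{k-1}) ↦ (x_{k+1}, x_k)` of the generalized momentum method with gradient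
error `w`: `y_k = x_k + ν (x_k - x_{k-1})` and
`x_{k+1} = x_k - α (∇f(y_k) + w) + β (x_k - x_{k-1})`. The heavy-ball method is the case `ν = 0`. -/
def step {d : ℕ} (f : E d → ℝ) (α β ν : ℝ) (w : E d) (ξ : State d) : State d :=
  (ξ.1 - α • (gradient f (ξ.1 + ν • (ξ.1 - ξ.2)) + w) + β • (ξ.1 - ξ.2), ξ.1)

/-- The state `ξ_k` after `k` inexact steps from the initialization `ξ₀ = (x_0, x_{-1})`, with
gradient errors `w_0, w_1, …`. -/
def state {d : ℕ} (f : E d → ℝ) (α β ν : ℝ) (w : ℕ → E d) (ξ₀ : State d) : ℕ → State d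
  | 0 => ξ₀
  | k + 1 => step f α β ν (w k) (state f α β ν w ξ₀ k)

/-- The iterate `x_k`. -/
def iterate {d : ℕ} (f : E d → ℝ) (α β ν : ℝ) (w : ℕ → E d) (ξ₀ : State d) (k : ℕ) : E d :=
  (state f α β ν w ξ₀ k).1

/-- The method, started in a state of `S`, has `ℓ₂` gain at most `γ` from the gradient errors to
the suboptimality: there is `H ≥ 0` on the states with `H(ξ_*) = 0` at `ξ_* = (x_*, x_*)` such that
`∑ (f(x_k) - f(x_*)) ≤ γ² ∑ ‖w_k‖² + H(ξ₀)` for all initial states `ξ₀ ∈ S` and all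
square-summable errors `w`. The sums of nonnegative terms are taken in `[0, ∞]`. -/
def HasGainLE {d : ℕ} (f : E d → ℝ) (xstar : E d) (α β ν : ℝ) (S : Set (State d)) (γ : ℝ≥0) :
    Prop :=
  ∃ H : State d → ℝ≥0, H (xstar, xstar) = 0 ∧
    ∀ ξ₀ ∈ S, ∀ w : ℕ → E d, Summable (fun k => ‖w k‖ ^ 2) →
      ∑' k, ENNReal.ofReal (f (iterate f α β ν w ξ₀ k) - f xstar) ≤
        (γ : ℝ≥0∞) ^ 2 * ∑' k, ENNReal.ofReal (‖w k‖ ^ 2) + (H ξ₀ : ℝ≥0∞)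

/-- The `ℓ₂` gain `L_{2,*}`: the infimum of the admissible `γ` (it is `∞` if there is none). -/
def l2Gain {d : ℕ} (f : E d → ℝ) (xstar : E d) (α β ν : ℝ) (S : Set (State d)) : ℝ≥0∞ :=
  ⨅ (γ : ℝ≥0) (_ : HasGainLE f xstar α β ν S γ), (γ : ℝ≥0∞)

/-- The initial states with `x_{-1} = x_0`. -/
def restStates (d : ℕ) : Set (State d) := {ξ | ξ.2 = ξ.1}

/-- The iteration matrix
`A_Q = [[(1+β) I - α(1+ν) Q, -β I + αν Q], [I, 0]]` of the method on a quadratic. -/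
def iterMatrix {d : ℕ} (Q : Matrix (Fin d) (Fin d) ℝ) (α β ν : ℝ) :
    Matrix (Fin d ⊕ Fin d) (Fin d ⊕ Fin d) ℝ :=
  Matrix.fromBlocks ((1 + β) • 1 - (α * (1 + ν)) • Q) (-β • 1 + (α * ν) • Q) 1 0

/-- The convergence rate `ρ(A_Q)`: the largest modulus of the complex eigenvalues of `A_Q`. -/
def rate {d : ℕ} (Q : Matrix (Fin d) (Fin d) ℝ) (α β ν : ℝ) : ℝ≥0∞ :=
  spectralRadius ℂ ((iterMatrix Q α β ν).map Complex.ofReal)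

/-- The input matrix `B = [-α I; 0]`. -/
def inMatrix (d : ℕ) (α : ℝ) : Matrix (Fin d ⊕ Fin d) (Fin d) ℝ :=
  Matrix.fromRows (-α • 1) 0

/-- The output matrix `T = [2^{-1/2} Λ^{1/2} Uᵀ, 0]` of an eigenvalue decomposition
`Q = U Λ Uᵀ` with `Λ = diag(lam)`. -/
def outMatrix {d : ℕ} (U : Matrix (Fin d) (Fin d) ℝ) (lam : Fin d → ℝ) :
    Matrix (Fin d) (Fin d ⊕ Fin d) ℝ :=
  Matrix.fromCols
    ((1 / Real.sqrt 2) • (Matrix.diagonal (fun i => Real.sqrt (lam i)) * Uᵀ)) 0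

/-- The transfer matrix `G(z) = T (z I - A_Q)⁻¹ B`. -/
def transferMatrix {d : ℕ} (U : Matrix (Fin d) (Fin d) ℝ) (lam : Fin d → ℝ) (α β ν : ℝ) (z : ℂ) :
    Matrix (Fin d) (Fin d) ℂ :=
  (outMatrix U lam).map Complex.ofReal *
    (z • 1 - (iterMatrix (U * Matrix.diagonal lam * Uᵀ) α β ν).map Complex.ofReal)⁻¹ *
      (inMatrix d α).map Complex.ofReal

/-- `H_∞ = max_{|z| = 1} ‖G(z)‖`, with the spectral norm. It is used only if `ρ(A_Q) < 1`; then
`G` is continuous on the unit circle. -/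
def hInf {d : ℕ} (U : Matrix (Fin d) (Fin d) ℝ) (lam : Fin d → ℝ) (α β ν : ℝ) : ℝ≥0∞ :=
  ⨆ z ∈ Metric.sphere (0 : ℂ) 1,
    ENNReal.ofReal ‖Matrix.toEuclideanCLM (n := Fin d) (𝕜 := ℂ) (transferMatrix U lam α β ν z)‖

/-- The function `a(κ)` of the robustly stable heavy-ball method. -/
def rsA (κ : ℝ) : ℝ :=
  if 32 ≤ κ then Real.sqrt κ * (Real.sqrt (2 * κ - 1) - 1) / (κ - 1) else 1

end GMM

end

/-! An eigenbasis of `Q` splits the method into scalar recursions, one per eigenvalue `λ`. For heavy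
ball with `β = b²` and `x = αλ`, the mode has characteristic polynomial `z² - (1 + b² - x) z + b²`.
The parameters are chosen so that `αμ = (1 - b)²` and `αL ≤ 1 + b²`, hence `(1 - b)² ≤ x ≤ 1 + b²`
on every mode.

Upper bounds. On this range `exists_storage` gives each mode a nonnegative quadratic storage
function whose increase is at most the squared input minus `x (1 - b)²` times the squared position.
Summed over the modes and divided by `2α²μ`, it certifies the gain `1/√(2μ)` by telescoping.
Evaluated on the signal `z^k` with `|z| = 1`, where the storage is stationary, the same inequality
bounds the characteristic polynomial from below and hence `H_∞` from above.

Lower bounds. Momentum has no effect at frequency zero: at `z = 1` every modal polynomial equals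
`αλ`, so the response of the mode `μ` is `1/√(2μ)` whatever `β` and `ν` are. In the time domain,
holding the iterate at a unit eigenvector of `μ` away from `x_*` costs `μ²` in error energy per step
and yields suboptimality `μ/2`. Holding it for a long time makes the cost of moving there and back
negligible.

The rate. All modes have nonpositive discriminant, so all eigenvalues have modulus exactly `b`. -/

namespace GMM

/-! ### A storage function for the scalar heavy-ball recursion -/

/-- A nonnegative quadratic storage function for the recursion `u = c v - b² w` with
`c = 1 + b² - x`: the supply rate is `(u - c v + b² w)² - x (1 - b)² v²`. -/
theorem exists_storage {b x : ℝ} (hb0 : 0 < b) (hb1 : b < 1) (hx0 : (1 - b) ^ 2 ≤ x)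
    (hx1 : x ≤ 1 + b ^ 2) :
    ∃ A B C : ℝ, (∀ u v, 0 ≤ A * u ^ 2 + B * u * v + C * v ^ 2) ∧
      ∀ u v w, (A * u ^ 2 + B * u * v + C * v ^ 2) - (A * v ^ 2 + B * v * w + C * w ^ 2) ≤
        (u - (1 + b ^ 2 - x) * v + b ^ 2 * w) ^ 2 - x * (1 - b) ^ 2 * v ^ 2 := by
  obtain ⟨c, hc⟩ : ∃ c, c = 1 + b ^ 2 - x := ⟨_, rfl⟩
  have hxc : x = 1 + b ^ 2 - c := by linarith
  have hc0 : 0 ≤ c := by linarith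
  have hc2 : c ≤ 2 * b := by nlinarith
  have hbb : b ^ 2 < 1 := by nlinarith
  have hb2 : 0 < b ^ 2 := by positivity
  have hxpos : 0 < x := lt_of_lt_of_le (by nlinarith) hx0
  have hA : 0 < 1 - b ^ 2 := by linarith
  rw [← hc]
  -- a quadratic form with positive leading coefficient and nonpositive discriminant
  have psd : ∀ {A B C : ℝ}, 0 < A → B ^ 2 ≤ 4 * A * C →
      ∀ u v, 0 ≤ A * u ^ 2 + B * u * v + C * v ^ 2 := by
    intro A B C hA hd u v
    have h1 : 0 ≤ 4 * A * (A * u ^ 2 + B * u * v + C * v ^ 2) := by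
      have : 4 * A * (A * u ^ 2 + B * u * v + C * v ^ 2) =
        (2 * A * u + B * v) ^ 2 + (4 * A * C - B ^ 2) * v ^ 2 := by ring
      rw [this]
      have := sub_nonneg.2 hd
      positivity
    exact nonneg_of_mul_nonneg_right h1 (by positivity)
  -- On the unit circle with `t = Re z`, `|z² - cz + b²|² = 4b²t² - 2(1 + b²)ct + c² + (1 - b²)²`.
  -- The vertex `t = (1 + b²)c/(4b²)` lies in `[-1, 1]` in the first case and at or beyond `t = 1`
  -- in the second. Each storage comes from writing the excess over `x(1 - b)²` as squares: about
  -- the vertex, respectively in powers of `1 - t`.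
  rcases le_total ((1 + b ^ 2) * c) (4 * b ^ 2) with h | h
  · refine ⟨1 - b ^ 2, -(c * (1 - b ^ 2)), b ^ 2 * (1 - b ^ 2), psd hA ?_, ?_⟩
    · have : c ^ 2 ≤ 4 * b ^ 2 := by nlinarith
      have := mul_le_mul_of_nonneg_left this (sq_nonneg (1 - b ^ 2))
      nlinarith
    · intro u v w
      -- Up to the factor `(1 - b)²/(4b²)`, this is the value at the vertex minus `x(1 - b)²`.
      have hh : 0 ≤ 8 * b ^ 3 + 4 * b ^ 2 * c - (1 + b) ^ 2 * c ^ 2 := by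
        have h1 : 0 ≤ (1 + b ^ 2) * (8 * b ^ 3 + 4 * b ^ 2 * c - (1 + b) ^ 2 * c ^ 2) := by
          have h2 := mul_le_mul_of_nonneg_left h (mul_nonneg (sq_nonneg (1 + b)) hc0)
          have h3 : 0 ≤ 8 * b ^ 3 * (1 + b ^ 2 - c) := mul_nonneg (by positivity) (by linarith)
          nlinarith
        exact nonneg_of_mul_nonneg_right h1 (by positivity)
      have h4 : 4 * b ^ 2 * ((u - c * v + b ^ 2 * w) ^ 2 - x * (1 - b) ^ 2 * v ^ 2
          - ((1 - b ^ 2) * u ^ 2 + -(c * (1 - b ^ 2)) * u * v + b ^ 2 * (1 - b ^ 2) * v ^ 2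
            - ((1 - b ^ 2) * v ^ 2 + -(c * (1 - b ^ 2)) * v * w + b ^ 2 * (1 - b ^ 2) * w ^ 2)))
          = (2 * b ^ 2 * u - (1 + b ^ 2) * c * v + 2 * b ^ 2 * w) ^ 2
            + (1 - b) ^ 2 * (8 * b ^ 3 + 4 * b ^ 2 * c - (1 + b) ^ 2 * c ^ 2) * v ^ 2 := by
        rw [hxc]; ring
      have h5 : 0 ≤ (2 * b ^ 2 * u - (1 + b ^ 2) * c * v + 2 * b ^ 2 * w) ^ 2
            + (1 - b) ^ 2 * (8 * b ^ 3 + 4 * b ^ 2 * c - (1 + b) ^ 2 * c ^ 2) * v ^ 2 := by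
        positivity
      rw [← h4] at h5
      have := nonneg_of_mul_nonneg_right h5 (by positivity)
      linarith
  · refine ⟨1 - b ^ 2, 4 * b ^ 2 - 2 * c, (1 + b ^ 2) * c - 3 * b ^ 2 - b ^ 4, psd hA ?_, ?_⟩
    -- This product is `(4AC - B²)/4`; its first factor is `x`.
    · have h1 : 0 ≤ (1 + b ^ 2 - c) * (c - b ^ 2 * (3 - b ^ 2)) := by
        refine mul_nonneg (by linarith) ?_
        have h2 : 0 ≤ (1 + b ^ 2) * (c - b ^ 2 * (3 - b ^ 2)) := by
          have : 0 ≤ b ^ 2 * (1 - b ^ 2) ^ 2 := by positivity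
          nlinarith
        exact nonneg_of_mul_nonneg_right h2 (by positivity)
      nlinarith
    · intro u v w
      have h4 : (u - c * v + b ^ 2 * w) ^ 2 - x * (1 - b) ^ 2 * v ^ 2
          - ((1 - b ^ 2) * u ^ 2 + (4 * b ^ 2 - 2 * c) * u * v
              + ((1 + b ^ 2) * c - 3 * b ^ 2 - b ^ 4) * v ^ 2
            - ((1 - b ^ 2) * v ^ 2 + (4 * b ^ 2 - 2 * c) * v * w
              + ((1 + b ^ 2) * c - 3 * b ^ 2 - b ^ 4) * w ^ 2))
          = b ^ 2 * (u - 2 * v + w) ^ 2 + ((1 + b ^ 2) * c - 4 * b ^ 2) * (v - w) ^ 2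
            + x * (x - (1 - b) ^ 2) * v ^ 2 := by
        rw [hxc]; ring
      have h5 : 0 ≤ b ^ 2 * (u - 2 * v + w) ^ 2 + ((1 + b ^ 2) * c - 4 * b ^ 2) * (v - w) ^ 2
            + x * (x - (1 - b) ^ 2) * v ^ 2 := by
        have := sub_nonneg.2 h
        have := sub_nonneg.2 hx0
        positivity
      linarith

/-- The dissipation inequality is applied to the real and imaginary parts of `(z², z, 1)` and added.
Shifting the signal multiplies it by `z`, so for `|z| = 1` the storage terms cancel. -/
theorem le_norm_sq_charpoly {b x : ℝ} (hb0 : 0 < b) (hb1 : b < 1) (hx0 : (1 - b) ^ 2 ≤ x)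
    (hx1 : x ≤ 1 + b ^ 2) {z : ℂ} (hz : ‖z‖ = 1) :
    x * (1 - b) ^ 2 ≤ ‖z ^ 2 - ((1 + b ^ 2 - x : ℝ) : ℂ) * z + ((b ^ 2 : ℝ) : ℂ)‖ ^ 2 := by
  obtain ⟨A, B, C, -, h⟩ := exists_storage hb0 hb1 hx0 hx1
  have h1 := h (z ^ 2).re z.re 1
  have h2 := h (z ^ 2).im z.im 0
  have hz2 : z.re ^ 2 + z.im ^ 2 = 1 := by
    have := Complex.sq_norm z
    rw [hz, Complex.normSq_apply] at this
    nlinarith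
  rw [Complex.sq_norm, Complex.normSq_apply]
  have e1 : (z ^ 2).re = z.re ^ 2 - z.im ^ 2 := by simp [pow_two]
  have e2 : (z ^ 2).im = 2 * z.re * z.im := by simp [pow_two]; ring
  rw [e1] at h1
  rw [e2] at h2
  rw [Complex.add_re, Complex.add_im, Complex.sub_re, Complex.sub_im, Complex.re_ofReal_mul,
    Complex.im_ofReal_mul, Complex.ofReal_re, Complex.ofReal_im, e1, e2]
  generalize z.re = p at *
  generalize z.im = q at *
  have k1 : (p ^ 2 - q ^ 2) ^ 2 + (2 * p * q) ^ 2 = 1 := by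
    have : (p ^ 2 - q ^ 2) ^ 2 + (2 * p * q) ^ 2 = (p ^ 2 + q ^ 2) ^ 2 := by ring
    rw [this, hz2, one_pow]
  have k2 : (p ^ 2 - q ^ 2) * p + 2 * p * q * q = p := by
    have : (p ^ 2 - q ^ 2) * p + 2 * p * q * q = (p ^ 2 + q ^ 2) * p := by ring
    rw [this, hz2, one_mul]
  have k3 := congrArg (A * ·) k1
  have k4 := congrArg (B * ·) k2
  have k5 := congrArg ((C - A + x * (1 - b) ^ 2) * ·) hz2
  beta_reduce at k3 k4 k5
  linarith

/-! ### The function `a` -/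

theorem rsA_eq {κ : ℝ} (h : 32 ≤ κ) : rsA κ = √κ * (2 / (√(2 * κ - 1) + 1)) := by
  have h1 : √(2 * κ - 1) ^ 2 = 2 * κ - 1 := Real.sq_sqrt (by linarith)
  have h2 : 0 ≤ √(2 * κ - 1) := Real.sqrt_nonneg _
  rw [rsA, if_pos h, mul_div_assoc]
  congr 1
  rw [div_eq_div_iff (by linarith) (by linarith)]
  linarith

theorem rsA_div_sqrt {κ : ℝ} (h : 32 ≤ κ) : rsA κ / √κ = 2 / (√(2 * κ - 1) + 1) := by
  rw [rsA_eq h, mul_div_cancel_left₀]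
  exact (Real.sqrt_pos.2 (by linarith)).ne'

theorem seven_le_sqrt {κ : ℝ} (h : 32 ≤ κ) : 7 ≤ √(2 * κ - 1) :=
  Real.le_sqrt_of_sq_le (by linarith)

theorem rsA_div_sqrt_le {κ : ℝ} (h : 32 ≤ κ) : rsA κ / √κ ≤ 1 / 4 := by
  have := seven_le_sqrt h
  rw [rsA_div_sqrt h, div_le_div_iff₀ (by linarith) (by norm_num)]
  linarith

/-- The equation that defines `a`: since `αL = a²`, it says `αL = 1 + β`, so the largest eigenvalue
sits at the end of the range allowed by `exists_storage`. -/
theorem rsA_sq {κ : ℝ} (h : 32 ≤ κ) : rsA κ ^ 2 = 1 + (1 - rsA κ / √κ) ^ 2 := by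
  have h1 : √(2 * κ - 1) ^ 2 = 2 * κ - 1 := Real.sq_sqrt (by linarith)
  have h2 : 0 ≤ √(2 * κ - 1) := Real.sqrt_nonneg _
  have h3 : √κ ^ 2 = κ := Real.sq_sqrt (by linarith)
  rw [rsA_div_sqrt h, rsA_eq h, mul_pow, h3]
  generalize √(2 * κ - 1) = q at *
  obtain rfl : κ = (q ^ 2 + 1) / 2 := by linarith
  have h4 : q + 1 ≠ 0 := by linarith
  field_simp
  ring

theorem rsA_pos {κ : ℝ} (h : 1 < κ) : 0 < rsA κ := by
  rcases le_or_gt 32 κ with h' | h'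
  · rw [rsA_eq h']; positivity
  · rw [rsA, if_neg h'.not_ge]; norm_num

theorem rsA_div_sqrt_lt_one {κ : ℝ} (h : 1 < κ) : rsA κ / √κ < 1 := by
  rcases le_or_gt 32 κ with h' | h'
  · linarith [rsA_div_sqrt_le h']
  · rw [rsA, if_neg h'.not_ge, div_lt_one (Real.sqrt_pos.2 (by linarith))]
    exact Real.lt_sqrt_of_sq_lt (by linarith)

theorem rsA_sq_le (κ : ℝ) : rsA κ ^ 2 ≤ 1 + (1 - rsA κ / √κ) ^ 2 := by
  rcases le_or_gt 32 κ with h' | h'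
  · rw [rsA_sq h']
  · have : rsA κ = 1 := by rw [rsA, if_neg h'.not_ge]
    rw [this]; nlinarith [sq_nonneg (1 - 1 / √κ)]

theorem five_quarters_lt_rsA {κ : ℝ} (h : 32 ≤ κ) : 5 / 4 < rsA κ := by
  have h1 := rsA_sq h
  have h2 := rsA_div_sqrt_le h
  have h3 := rsA_pos (by linarith : 1 < κ)
  have h4 : rsA κ / √κ < 1 / 4 := by
    have h8 : (7 : ℝ) < √(2 * κ - 1) := Real.lt_sqrt_of_sq_lt (by linarith)
    rw [rsA_div_sqrt h, div_lt_div_iff₀ (by linarith) (by norm_num)]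
    linarith
  nlinarith

/-- At `32` the function jumps up from `1`. Beyond it, `s = a/√κ = 2/(√(2κ - 1) + 1)` decreases, so
`a² = 1 + (1 - s)²` increases. -/
theorem monotoneOn_rsA : MonotoneOn rsA (Set.Ioi 1) := by
  intro x _ y _ hxy
  rcases lt_or_ge x 32 with hx | hx
  · have e : rsA x = 1 := by rw [rsA, if_neg hx.not_ge]
    rcases lt_or_ge y 32 with hy | hy
    · rw [e, rsA, if_neg hy.not_ge]
    · linarith [five_quarters_lt_rsA hy]
  · have hy : 32 ≤ y := hx.trans hxy
    have h1 : rsA y / √y ≤ rsA x / √x := by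
      rw [rsA_div_sqrt hx, rsA_div_sqrt hy]
      have := seven_le_sqrt hx
      gcongr
    have h2 := rsA_div_sqrt_le hx
    refine le_of_sq_le_sq ?_ (rsA_pos (by linarith)).le
    rw [rsA_sq hx, rsA_sq hy]
    gcongr
    linarith

theorem rsA_asymptotic_bounds {κ : ℝ} (h : 32 ≤ κ) :
    |rsA κ - (√2 - 1 / √κ)| ≤ 8 * (1 / κ) ∧ |rsA κ - √2| ≤ 4 * (1 / √κ) := by
  obtain ⟨a, ha⟩ : ∃ a, a = rsA κ := ⟨_, rfl⟩
  obtain ⟨q, hq⟩ : ∃ q, q = 1 / √κ := ⟨_, rfl⟩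
  have hκ : 0 < √κ := Real.sqrt_pos.2 (by linarith)
  have hq0 : 0 < q := by rw [hq]; positivity
  have hq2 : 1 / κ = q ^ 2 := by rw [hq, div_pow, Real.sq_sqrt (by linarith), one_pow]
  have h1 := rsA_sq h
  have h2 := rsA_div_sqrt_le h
  have h3 := five_quarters_lt_rsA h
  rw [← ha] at h1 h2 h3 ⊢
  rw [div_eq_mul_one_div a, ← hq] at h1 h2
  rw [hq2, ← hq]
  have hs0 : 0 < a * q := by positivity
  have ha2 : a ^ 2 ≤ 2 := by nlinarith
  have ha3 : a ≤ √2 := Real.le_sqrt_of_sq_le ha2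
  have hr2 : √2 ^ 2 = 2 := Real.sq_sqrt (by norm_num)
  obtain ⟨t, ht⟩ : ∃ t, t = √2 := ⟨_, rfl⟩
  rw [← ht] at ha3 hr2 ⊢
  have hta : 2 < t + a := by linarith
  have ht2 : t ≤ 3 / 2 := by nlinarith
  -- `rsA_sq` reads `2 - a² = aq(2 - aq)`; dividing by `t + a > 2` turns it into bounds on `√2 - a`.
  have hd : (t - a) * (t + a) = a * q * (2 - a * q) := by nlinarith
  have hd1 : t - a ≤ 2 * q := by
    have : (t - a) * 2 ≤ (t - a) * (t + a) :=
      mul_le_mul_of_nonneg_left hta.le (by linarith)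
    nlinarith
  refine ⟨?_, by rw [abs_le]; constructor <;> linarith⟩
  have he : (a - (t - q)) * (t + a) = q * ((t - a) + a * (a * q)) := by nlinarith
  have he1 : 0 ≤ (a - (t - q)) * (t + a) := by
    rw [he]
    have : 0 ≤ t - a := by linarith
    positivity
  have he2 : 0 ≤ a - (t - q) := nonneg_of_mul_nonneg_left he1 (by linarith)
  rw [abs_of_nonneg he2]
  have : (a - (t - q)) * 2 ≤ (a - (t - q)) * (t + a) := mul_le_mul_of_nonneg_left hta.le he2
  have h6 : a * (a * q) ≤ 2 * q := by nlinarith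
  have h7 : q * ((t - a) + a * (a * q)) ≤ q * (4 * q) :=
    mul_le_mul_of_nonneg_left (by linarith) hq0.le
  nlinarith

theorem isBigO_rsA : (fun κ : ℝ => rsA κ - (√2 - 1 / √κ)) =O[atTop] (fun κ : ℝ => 1 / κ) := by
  refine IsBigO.of_bound 8 ?_
  filter_upwards [eventually_ge_atTop 32] with κ h
  rw [Real.norm_eq_abs, Real.norm_eq_abs, abs_of_nonneg (by positivity : 0 ≤ 1 / κ)]
  exact (rsA_asymptotic_bounds h).1

theorem isBigO_rsA_rate :
    (fun κ : ℝ => (1 - rsA κ / √κ) - (1 - √2 / √κ)) =O[atTop] (fun κ : ℝ => 1 / κ) := by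
  refine IsBigO.of_bound 4 ?_
  filter_upwards [eventually_ge_atTop 32] with κ h
  have hκ : 0 < √κ := Real.sqrt_pos.2 (by linarith)
  have e : (1 - rsA κ / √κ) - (1 - √2 / √κ) = -((rsA κ - √2) * (1 / √κ)) := by ring
  have e2 : 1 / κ = 1 / √κ * (1 / √κ) := by
    rw [div_mul_div_comm, Real.mul_self_sqrt (by linarith), one_mul]
  rw [Real.norm_eq_abs, Real.norm_eq_abs, abs_of_nonneg (by positivity : 0 ≤ 1 / κ), e, abs_neg,
    abs_mul, abs_of_pos (by positivity : 0 < 1 / √κ), e2, ← mul_assoc]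
  exact mul_le_mul_of_nonneg_right (rsA_asymptotic_bounds h).2 (by positivity)

/-! ### Diagonalization of the iteration matrix -/

variable {d : ℕ}

theorem transpose_mul_self_of_orthogonal {U : Matrix (Fin d) (Fin d) ℝ}
    (hU : U ∈ Matrix.orthogonalGroup (Fin d) ℝ) : Uᵀ * U = 1 := by
  have := (Matrix.mem_orthogonalGroup_iff' (Fin d) ℝ).1 hU
  simpa using this

theorem mul_transpose_self_of_orthogonal {U : Matrix (Fin d) (Fin d) ℝ}
    (hU : U ∈ Matrix.orthogonalGroup (Fin d) ℝ) : U * Uᵀ = 1 := by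
  have := (Matrix.mem_orthogonalGroup_iff (Fin d) ℝ).1 hU
  simpa using this

theorem map_ofReal_mul (A B : Matrix (Fin d) (Fin d) ℝ) :
    (A * B).map Complex.ofReal = A.map Complex.ofReal * B.map Complex.ofReal :=
  Matrix.map_mul (f := Complex.ofRealHom)

theorem map_transpose_mul_self_of_orthogonal {U : Matrix (Fin d) (Fin d) ℝ}
    (hU : U ∈ Matrix.orthogonalGroup (Fin d) ℝ) :
    (U.map Complex.ofReal)ᵀ * U.map Complex.ofReal = 1 := by
  rw [← Matrix.transpose_map, ← map_ofReal_mul, transpose_mul_self_of_orthogonal hU]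
  exact Matrix.map_one _ Complex.ofReal_zero Complex.ofReal_one

theorem spectrum_orthogonal_conj {U : Matrix (Fin d) (Fin d) ℝ}
    (hU : U ∈ Matrix.orthogonalGroup (Fin d) ℝ) (lam : Fin d → ℝ) :
    spectrum ℝ (U * Matrix.diagonal lam * Uᵀ) = Set.range lam := by
  have := spectrum.units_conjugate (R := ℝ) (a := Matrix.diagonal lam)
    (u := ⟨U, Uᵀ, mul_transpose_self_of_orthogonal hU, transpose_mul_self_of_orthogonal hU⟩)
  rw [spectrum_diagonal] at this
  exact this

theorem exists_orthogonal_diagonalization {Q : Matrix (Fin d) (Fin d) ℝ} (hQ : Q.IsHermitian) :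
    ∃ U ∈ Matrix.orthogonalGroup (Fin d) ℝ, ∃ lam : Fin d → ℝ,
      Q = U * Matrix.diagonal lam * Uᵀ := by
  refine ⟨hQ.eigenvectorUnitary, hQ.eigenvectorUnitary.2, hQ.eigenvalues, ?_⟩
  conv_lhs => rw [hQ.spectral_theorem]
  simp [Unitary.conjStarAlgAut_apply, Matrix.star_eq_conjTranspose,
    Matrix.conjTranspose_eq_transpose_of_trivial]

/-- The characteristic polynomial of the method on the mode with eigenvalue `l`. -/
def modePoly (α β ν l : ℝ) (z : ℂ) : ℂ :=
  z ^ 2 - ((1 + β - α * (1 + ν) * l : ℝ) : ℂ) * z + ((β - α * ν * l : ℝ) : ℂ)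

/-- A mode growing like `z^k` has states proportional to `(z, 1)`, so the columns `(z uᵢ, uᵢ)`
reduce the resolvent to the modal polynomials without inverting a block matrix. -/
theorem sub_iterMatrix_mul {U : Matrix (Fin d) (Fin d) ℝ}
    (hU : U ∈ Matrix.orthogonalGroup (Fin d) ℝ) (lam : Fin d → ℝ) (α β ν : ℝ) (z : ℂ) :
    (z • 1 - (iterMatrix (U * Matrix.diagonal lam * Uᵀ) α β ν).map Complex.ofReal) *
        Matrix.fromRows (z • U.map Complex.ofReal) (U.map Complex.ofReal) =
      Matrix.fromRows (U.map Complex.ofReal *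
        Matrix.diagonal (fun i => modePoly α β ν (lam i) z)) 0 := by
  have hQ : U * Matrix.diagonal lam * Uᵀ * U = U * Matrix.diagonal lam := by
    rw [Matrix.mul_assoc, transpose_mul_self_of_orthogonal hU, Matrix.mul_one]
  have hQ' : (U * Matrix.diagonal lam * Uᵀ).map Complex.ofReal * U.map Complex.ofReal =
      U.map Complex.ofReal * Matrix.diagonal (fun i => (lam i : ℂ)) := by
    rw [← map_ofReal_mul, hQ, map_ofReal_mul, Matrix.diagonal_map Complex.ofReal_zero]
  generalize U * Matrix.diagonal lam * Uᵀ = Q at *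
  have e : z • 1 - (iterMatrix Q α β ν).map Complex.ofReal =
      Matrix.fromBlocks (z • 1 - (((1 + β : ℝ) : ℂ) • 1 - ((α * (1 + ν) : ℝ) : ℂ) • Q.map Complex.ofReal))
        (((β : ℝ) : ℂ) • 1 - ((α * ν : ℝ) : ℂ) • Q.map Complex.ofReal) (-1) (z • 1) := by
    ext (i | i) (j | j) <;> simp [iterMatrix, Matrix.one_apply, apply_ite Complex.ofReal,
      Matrix.fromBlocks]
    all_goals ring
  rw [e, Matrix.fromBlocks_mul_fromRows]
  congr 1
  · simp only [Matrix.sub_mul, Matrix.smul_mul, Matrix.mul_smul, Matrix.one_mul, hQ']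
    ext i j
    simp [modePoly, Matrix.mul_diagonal]
    ring
  · simp

theorem det_sub_iterMatrix_eq_zero_iff {U : Matrix (Fin d) (Fin d) ℝ}
    (hU : U ∈ Matrix.orthogonalGroup (Fin d) ℝ) (lam : Fin d → ℝ) (α β ν : ℝ) (z : ℂ) :
    (z • 1 - (iterMatrix (U * Matrix.diagonal lam * Uᵀ) α β ν).map Complex.ofReal).det = 0 ↔
      ∃ i, modePoly α β ν (lam i) z = 0 := by
  have hW := map_transpose_mul_self_of_orthogonal hU
  have hW' := mul_eq_one_comm.1 hW
  have key := sub_iterMatrix_mul hU lam α β ν z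
  -- The lower block row forces kernel vectors into the span of the columns `(z uᵢ, uᵢ)`.
  have hrow : ∀ v : Fin d ⊕ Fin d → ℂ, ((z • 1 - (iterMatrix (U * Matrix.diagonal lam * Uᵀ) α β ν).map
      Complex.ofReal) *ᵥ v) = 0 → v ∘ Sum.inl = z • (v ∘ Sum.inr) := by
    intro v hv
    ext i
    have := congrFun hv (Sum.inr i)
    simp [Matrix.sub_mulVec, Matrix.smul_mulVec, iterMatrix, Matrix.fromBlocks_map,
      Matrix.fromBlocks_mulVec] at this
    simp
    linear_combination -this
  generalize z • 1 - (iterMatrix (U * Matrix.diagonal lam * Uᵀ) α β ν).map Complex.ofReal = M at *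
  generalize U.map Complex.ofReal = W at *
  rw [← Matrix.exists_mulVec_eq_zero_iff]
  constructor
  · rintro ⟨v, hv0, hv⟩
    by_contra! hne
    have h1 := hrow v hv
    have h2 : v = Matrix.fromRows (z • W) W *ᵥ (Wᵀ *ᵥ (v ∘ Sum.inr)) := by
      rw [Matrix.fromRows_mulVec, Matrix.smul_mulVec, Matrix.mulVec_mulVec, hW', Matrix.one_mulVec,
        ← h1]
      ext (i | i) <;> rfl
    rw [h2, Matrix.mulVec_mulVec, key, Matrix.fromRows_mulVec] at hv
    have h3 : (W * Matrix.diagonal fun i => modePoly α β ν (lam i) z) *ᵥ (Wᵀ *ᵥ (v ∘ Sum.inr)) = 0 := by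
      ext i; exact congrFun hv (Sum.inl i)
    have h4 := congrArg (Wᵀ *ᵥ ·) h3
    simp only [Matrix.mulVec_mulVec, ← Matrix.mul_assoc, hW, Matrix.one_mul, Matrix.mulVec_zero] at h4
    have h5 : Wᵀ *ᵥ (v ∘ Sum.inr) = 0 := by
      ext i
      have := congrFun h4 i
      rw [← Matrix.mulVec_mulVec, Matrix.mulVec_diagonal] at this
      exact (mul_eq_zero.1 this).resolve_left (hne i)
    rw [h5, Matrix.mulVec_zero] at h2
    exact hv0 h2
  · rintro ⟨i, hi⟩
    refine ⟨Matrix.fromRows (z • W) W *ᵥ Pi.single i 1, ?_, ?_⟩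
    · intro h
      have h1 : W *ᵥ Pi.single i 1 = 0 := by
        rw [Matrix.fromRows_mulVec] at h
        ext j; exact congrFun h (Sum.inr j)
      have h2 := congrArg (Wᵀ *ᵥ ·) h1
      simp only [Matrix.mulVec_mulVec, hW, Matrix.one_mulVec, Matrix.mulVec_zero] at h2
      simpa using congrFun h2 i
    · rw [Matrix.mulVec_mulVec, key, Matrix.fromRows_mulVec, ← Matrix.mulVec_mulVec]
      have : (Matrix.diagonal fun i => modePoly α β ν (lam i) z) *ᵥ Pi.single i 1 = 0 := by
        ext j
        rw [Matrix.mulVec_diagonal]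
        rcases eq_or_ne j i with rfl | h
        · simp [hi]
        · simp [h]
      rw [this]
      ext (j | j) <;> simp

theorem rate_eq_iSup {U : Matrix (Fin d) (Fin d) ℝ}
    (hU : U ∈ Matrix.orthogonalGroup (Fin d) ℝ) (lam : Fin d → ℝ) (α β ν : ℝ) :
    rate (U * Matrix.diagonal lam * Uᵀ) α β ν =
      ⨆ z ∈ {z : ℂ | ∃ i, modePoly α β ν (lam i) z = 0}, (‖z‖₊ : ℝ≥0∞) := by
  have : spectrum ℂ ((iterMatrix (U * Matrix.diagonal lam * Uᵀ) α β ν).map Complex.ofReal) =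
      {z : ℂ | ∃ i, modePoly α β ν (lam i) z = 0} := by
    ext z
    rw [spectrum.mem_iff, Algebra.algebraMap_eq_smul_one, Matrix.isUnit_iff_isUnit_det,
      isUnit_iff_ne_zero, not_not, det_sub_iterMatrix_eq_zero_iff hU, Set.mem_ofPred_eq]
  rw [rate, spectralRadius, this]

-- The transfer matrix is a diagonal matrix times a unitary one, so its spectral norm is the largest
-- modal gain; the norm on the right is the sup norm.
open scoped Matrix.Norms.L2Operator in
theorem norm_transferMatrix {U : Matrix (Fin d) (Fin d) ℝ}
    (hU : U ∈ Matrix.orthogonalGroup (Fin d) ℝ) (lam : Fin d → ℝ) (α β ν : ℝ) {z : ℂ}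
    (hz : ∀ i, modePoly α β ν (lam i) z ≠ 0) :
    ‖Matrix.toEuclideanCLM (n := Fin d) (𝕜 := ℂ) (transferMatrix U lam α β ν z)‖ =
      ‖fun i => ((1 / √2 * √(lam i) * α : ℝ) : ℂ) * z / modePoly α β ν (lam i) z‖ := by
  have hW := map_transpose_mul_self_of_orthogonal hU
  have hW' := mul_eq_one_comm.1 hW
  have hWu : (U.map Complex.ofReal)ᵀ ∈ unitary (Matrix (Fin d) (Fin d) ℂ) := by
    have hs : star (U.map Complex.ofReal)ᵀ = U.map Complex.ofReal := by
      ext i j; simp [Matrix.star_apply]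
    rw [Unitary.mem_iff, hs]
    exact ⟨hW', hW⟩
  have hdet : IsUnit (z • 1 - (iterMatrix (U * Matrix.diagonal lam * Uᵀ) α β ν).map
      Complex.ofReal).det := by
    rw [isUnit_iff_ne_zero, Ne, det_sub_iterMatrix_eq_zero_iff hU]
    simpa using hz
  have key := sub_iterMatrix_mul hU lam α β ν z
  have hB : (z • 1 - (iterMatrix (U * Matrix.diagonal lam * Uᵀ) α β ν).map Complex.ofReal)⁻¹ *
      (inMatrix d α).map Complex.ofReal =
      Matrix.fromRows (z • U.map Complex.ofReal) (U.map Complex.ofReal) *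
        (Matrix.diagonal (fun i => -(α : ℂ) / modePoly α β ν (lam i) z) *
          (U.map Complex.ofReal)ᵀ) := by
    have hb : (inMatrix d α).map Complex.ofReal =
        (z • 1 - (iterMatrix (U * Matrix.diagonal lam * Uᵀ) α β ν).map Complex.ofReal) *
        (Matrix.fromRows (z • U.map Complex.ofReal) (U.map Complex.ofReal) *
        (Matrix.diagonal (fun i => -(α : ℂ) / modePoly α β ν (lam i) z) *
          (U.map Complex.ofReal)ᵀ)) := by
      rw [← Matrix.mul_assoc, key, Matrix.fromRows_mul, ← Matrix.mul_assoc,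
        Matrix.mul_assoc (U.map Complex.ofReal), Matrix.diagonal_mul_diagonal]
      have : (fun i => modePoly α β ν (lam i) z * (-(α : ℂ) / modePoly α β ν (lam i) z)) =
          fun _ => -(α : ℂ) := by
        ext i; rw [mul_div_cancel₀ _ (hz i)]
      have h1 : (Matrix.diagonal fun _ => -(α : ℂ)) = (-(α : ℂ)) • (1 : Matrix (Fin d) (Fin d) ℂ) := by
        rw [Matrix.smul_one_eq_diagonal]
      rw [this, h1, Matrix.mul_smul, Matrix.mul_one, Matrix.smul_mul, hW', Matrix.zero_mul]
      ext (i | i) j <;> simp [inMatrix, Matrix.one_apply, apply_ite Complex.ofReal]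
    rw [hb, Matrix.nonsing_inv_mul_cancel_left _ _ hdet]
  have hT : (outMatrix U lam).map Complex.ofReal = Matrix.fromCols
      (Matrix.diagonal (fun i => ((1 / √2 * √(lam i) : ℝ) : ℂ)) * (U.map Complex.ofReal)ᵀ) 0 := by
    ext i (j | j) <;> simp [outMatrix, Matrix.diagonal_mul, mul_assoc]
  have hG : transferMatrix U lam α β ν z =
      Matrix.diagonal (fun i => -(((1 / √2 * √(lam i) * α : ℝ) : ℂ) * z / modePoly α β ν (lam i) z)) *
        (U.map Complex.ofReal)ᵀ := by
    rw [transferMatrix, Matrix.mul_assoc, hB, hT, ← Matrix.mul_assoc, Matrix.fromCols_mul_fromRows,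
      Matrix.zero_mul, add_zero, Matrix.mul_smul, Matrix.mul_assoc, hW, Matrix.mul_one,
      ← Matrix.mul_assoc, Matrix.smul_mul, Matrix.diagonal_mul_diagonal, ← Matrix.diagonal_smul]
    congr 2
    ext i
    simp
    ring
  rw [hG, ← Matrix.cstar_norm_def, CStarRing.norm_mul_mem_unitary _ hWu, Matrix.l2_opNorm_diagonal]
  exact norm_neg (fun i => ((1 / √2 * √(lam i) * α : ℝ) : ℂ) * z / modePoly α β ν (lam i) z)

/-! ### The `H_∞` norm and the rate -/

theorem modePoly_one (α β ν l : ℝ) : modePoly α β ν l 1 = ((α * l : ℝ) : ℂ) := by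
  simp only [modePoly]
  push_cast
  ring

/-- The supremum is tested at `z = 1`, where `α` cancels from the modal gain and `β`, `ν` do not
enter. -/
theorem le_hInf {U : Matrix (Fin d) (Fin d) ℝ} (hU : U ∈ Matrix.orthogonalGroup (Fin d) ℝ)
    {lam : Fin d → ℝ} (hlam : ∀ i, 0 < lam i) {α : ℝ} (hα : 0 < α) (β ν : ℝ) (i : Fin d) :
    ENNReal.ofReal (1 / √(2 * lam i)) ≤ hInf U lam α β ν := by
  refine le_trans ?_ (le_iSup₂ (f := fun z (_ : z ∈ Metric.sphere (0 : ℂ) 1) => ENNReal.ofReal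
    ‖Matrix.toEuclideanCLM (n := Fin d) (𝕜 := ℂ) (transferMatrix U lam α β ν z)‖) 1 (by simp))
  refine ENNReal.ofReal_le_ofReal ?_
  have hne : ∀ i, modePoly α β ν (lam i) 1 ≠ 0 := by
    intro i
    rw [modePoly_one]
    exact_mod_cast (mul_pos hα (hlam i)).ne'
  rw [norm_transferMatrix hU lam α β ν hne]
  refine le_trans ?_ (norm_le_pi_norm _ i)
  have hl := hlam i
  have h2 : √(lam i) ^ 2 = lam i := Real.sq_sqrt hl.le
  have h3 : 0 < √(lam i) := Real.sqrt_pos.2 hl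
  rw [modePoly_one, mul_one, ← Complex.ofReal_div, Complex.norm_real, Real.norm_eq_abs,
    Real.sqrt_mul zero_le_two]
  refine le_trans (le_of_eq ?_) (le_abs_self _)
  field_simp
  rw [h2]

theorem hInf_heavyBall_le {U : Matrix (Fin d) (Fin d) ℝ}
    (hU : U ∈ Matrix.orthogonalGroup (Fin d) ℝ) {lam : Fin d → ℝ} (hlam : ∀ i, 0 < lam i)
    {α b μ : ℝ} (hα : 0 < α) (hμ : 0 < μ) (hb0 : 0 < b) (hb1 : b < 1) (hαμ : α * μ = (1 - b) ^ 2)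
    (h0 : ∀ i, μ ≤ lam i) (h1 : ∀ i, α * lam i ≤ 1 + b ^ 2) :
    hInf U lam α (b ^ 2) 0 ≤ ENNReal.ofReal (1 / √(2 * μ)) := by
  refine iSup₂_le fun z hz => ENNReal.ofReal_le_ofReal ?_
  have hz1 : ‖z‖ = 1 := by simpa using hz
  have hpoly : ∀ i, α * √(lam i) * √μ ≤ ‖modePoly α (b ^ 2) 0 (lam i) z‖ := by
    intro i
    refine le_of_sq_le_sq ?_ (norm_nonneg _)
    have := le_norm_sq_charpoly (x := α * lam i) hb0 hb1
      (hαμ ▸ mul_le_mul_of_nonneg_left (h0 i) hα.le) (h1 i) hz1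
    rw [← hαμ] at this
    rw [mul_pow, mul_pow, Real.sq_sqrt (hlam i).le, Real.sq_sqrt hμ.le, modePoly]
    simp only [add_zero, mul_one, mul_zero, zero_mul, sub_zero]
    linarith
  have hpos : ∀ i, 0 < α * √(lam i) * √μ := fun i =>
    mul_pos (mul_pos hα (Real.sqrt_pos.2 (hlam i))) (Real.sqrt_pos.2 hμ)
  have hppos := fun i => (hpos i).trans_le (hpoly i)
  rw [norm_transferMatrix hU lam α _ _ (fun i => norm_pos_iff.1 (hppos i))]
  refine (pi_norm_le_iff_of_nonneg (by positivity)).2 fun i => ?_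
  rw [norm_div, norm_mul, hz1, mul_one, Complex.norm_real, Real.norm_eq_abs,
    abs_of_nonneg (by positivity), div_le_div_iff₀ (hppos i) (Real.sqrt_pos.2 (by positivity)),
    one_mul, Real.sqrt_mul zero_le_two]
  refine le_trans (le_of_eq ?_) (hpoly i)
  field_simp

/-- The roots are conjugate or equal, with product `b²`. -/
theorem norm_eq_of_charpoly_eq_zero {c b : ℝ} (hb : 0 ≤ b) (hc : c ^ 2 ≤ 4 * b ^ 2) {z : ℂ}
    (hz : z ^ 2 - (c : ℂ) * z + ((b ^ 2 : ℝ) : ℂ) = 0) : ‖z‖ = b := by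
  have hre := congrArg Complex.re hz
  have him := congrArg Complex.im hz
  have e1 : (z ^ 2).re = z.re ^ 2 - z.im ^ 2 := by simp [pow_two]
  have e2 : (z ^ 2).im = 2 * z.re * z.im := by simp [pow_two]; ring
  rw [Complex.add_re, Complex.sub_re, Complex.re_ofReal_mul, Complex.ofReal_re, e1,
    Complex.zero_re] at hre
  rw [Complex.add_im, Complex.sub_im, Complex.im_ofReal_mul, Complex.ofReal_im, e2,
    Complex.zero_im] at him
  have key : z.re * z.re + z.im * z.im = b ^ 2 := by
    rcases eq_or_ne z.im 0 with hq | hq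
    · rw [hq] at hre ⊢
      have h1 : (z.re - c / 2) ^ 2 = 0 := le_antisymm (by nlinarith) (sq_nonneg _)
      have h2 : z.re = c / 2 := by
        have := pow_eq_zero_iff (two_ne_zero) |>.1 h1
        linarith
      have h3 : c = 2 * z.re := by linarith
      rw [h3] at hre
      linarith
    · have h1 : 2 * z.re - c = 0 := by
        have : (2 * z.re - c) * z.im = 0 := by linarith
        exact (mul_eq_zero.1 this).resolve_right hq
      have h3 : c = 2 * z.re := by linarith
      rw [h3] at hre
      linarith
  have := Complex.sq_norm z
  rw [Complex.normSq_apply, key] at this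
  exact (sq_eq_sq₀ (norm_nonneg _) hb).1 this

theorem rate_heavyBall {U : Matrix (Fin d) (Fin d) ℝ}
    (hU : U ∈ Matrix.orthogonalGroup (Fin d) ℝ) {lam : Fin d → ℝ}
    {α b : ℝ} (hb0 : 0 < b) {i₀ : Fin d} (hi₀ : α * lam i₀ = (1 - b) ^ 2)
    (h0 : ∀ i, (1 - b) ^ 2 ≤ α * lam i) (h1 : ∀ i, α * lam i ≤ 1 + b ^ 2) :
    rate (U * Matrix.diagonal lam * Uᵀ) α (b ^ 2) 0 = ENNReal.ofReal b := by
  rw [rate_eq_iSup hU]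
  apply le_antisymm
  · refine iSup₂_le fun z hz => ?_
    obtain ⟨i, hi⟩ := hz
    have h0 := h0 i
    have h1 := h1 i
    simp only [modePoly, add_zero, mul_one, mul_zero, zero_mul, sub_zero] at hi
    rw [← norm_eq_of_charpoly_eq_zero hb0.le (by nlinarith) hi, ofReal_norm]
    rfl
  -- For the mode `i₀` the polynomial is `(z - b)²`.
  · have : (b : ℂ) ∈ {z : ℂ | ∃ i, modePoly α (b ^ 2) 0 (lam i) z = 0} := by
      refine ⟨i₀, ?_⟩
      simp only [modePoly, add_zero, mul_one, mul_zero, zero_mul, sub_zero, hi₀]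
      push_cast
      ring
    refine le_trans (le_of_eq ?_) (le_iSup₂ (b : ℂ) this)
    rw [← enorm_eq_nnnorm, ← ofReal_norm, Complex.norm_real, Real.norm_eq_abs, abs_of_pos hb0]

/-! ### Quadratics -/

theorem gradient_quadratic {Q : Matrix (Fin d) (Fin d) ℝ} (hQ : Q.IsHermitian) (p : Fin d → ℝ)
    (r : ℝ) (x : E d) : gradient (quadratic Q p r) x = WithLp.toLp 2 (Q *ᵥ x.ofLp + p) := by
  refine HasGradientAt.gradient (hasGradientAt_iff_hasFDerivAt.2 ?_)
  have e : quadratic Q p r = fun x : E d =>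
      (1 / 2) * inner ℝ (Matrix.toEuclideanCLM (n := Fin d) (𝕜 := ℝ) Q x) x
        + inner ℝ x (WithLp.toLp 2 p) + r := by
    ext x
    simp [quadratic, EuclideanSpace.inner_eq_star_dotProduct, Matrix.ofLp_toEuclideanCLM]
  rw [e]
  have h1 := (((Matrix.toEuclideanCLM (n := Fin d) (𝕜 := ℝ) Q).hasFDerivAt (x := x)).inner ℝ
    (hasFDerivAt_id x)).const_mul (1 / 2)
  have h2 := (hasFDerivAt_id (𝕜 := ℝ) x).inner ℝ (hasFDerivAt_const (WithLp.toLp 2 p : E d) x)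
  refine ((h1.add h2).add_const r).congr_fderiv ?_
  ext y
  have hs : y.ofLp ⬝ᵥ Q *ᵥ x.ofLp = x.ofLp ⬝ᵥ Q *ᵥ y.ofLp := by
    rw [Matrix.dotProduct_mulVec, ← Matrix.mulVec_transpose, dotProduct_comm]
    congr 2
  simp [EuclideanSpace.inner_eq_star_dotProduct, Matrix.ofLp_toEuclideanCLM, fderivInnerCLM_apply]
  rw [hs, dotProduct_comm p]
  ring

theorem mulVec_add_eq_zero_of_minimizer {Q : Matrix (Fin d) (Fin d) ℝ} (hQ : Q.IsHermitian)
    {p : Fin d → ℝ} {r : ℝ} {xstar : E d}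
    (hmin : ∀ x, quadratic Q p r xstar ≤ quadratic Q p r x) : Q *ᵥ xstar.ofLp + p = 0 := by
  have h1 : IsLocalMin (quadratic Q p r) xstar := Filter.Eventually.of_forall hmin
  have h2 : gradient (quadratic Q p r) xstar = 0 := by
    rw [gradient, h1.fderiv_eq_zero, map_zero]
  rw [gradient_quadratic hQ] at h2
  simpa using congrArg WithLp.ofLp h2

theorem gradient_quadratic_of_minimizer {Q : Matrix (Fin d) (Fin d) ℝ} (hQ : Q.IsHermitian)
    {p : Fin d → ℝ} {r : ℝ} {xstar : E d}
    (hmin : ∀ x, quadratic Q p r xstar ≤ quadratic Q p r x) (x : E d) :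
    gradient (quadratic Q p r) x = WithLp.toLp 2 (Q *ᵥ (x - xstar).ofLp) := by
  rw [gradient_quadratic hQ, eq_neg_of_add_eq_zero_right (mulVec_add_eq_zero_of_minimizer hQ hmin),
    WithLp.ofLp_sub, Matrix.mulVec_sub, sub_eq_add_neg]

theorem quadratic_sub_of_minimizer {Q : Matrix (Fin d) (Fin d) ℝ} (hQ : Q.IsHermitian)
    {p : Fin d → ℝ} {r : ℝ} {xstar : E d}
    (hmin : ∀ x, quadratic Q p r xstar ≤ quadratic Q p r x) (x : E d) :
    quadratic Q p r x - quadratic Q p r xstar =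
      1 / 2 * ((x - xstar).ofLp ⬝ᵥ Q *ᵥ (x - xstar).ofLp) := by
  have hs : xstar.ofLp ⬝ᵥ Q *ᵥ x.ofLp = x.ofLp ⬝ᵥ Q *ᵥ xstar.ofLp := by
    rw [Matrix.dotProduct_mulVec, ← Matrix.mulVec_transpose, dotProduct_comm]
    congr 2
  rw [quadratic, quadratic,
    eq_neg_of_add_eq_zero_right (mulVec_add_eq_zero_of_minimizer hQ hmin)]
  simp only [WithLp.ofLp_sub, Matrix.mulVec_sub, dotProduct_sub, sub_dotProduct, neg_dotProduct, hs,
    dotProduct_comm (Q *ᵥ xstar.ofLp)]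
  ring

/-- The coordinates of `v` with respect to the columns of `U`. -/
def modes (U : Matrix (Fin d) (Fin d) ℝ) (v : E d) : Fin d → ℝ := Uᵀ *ᵥ v.ofLp

theorem modes_add (U : Matrix (Fin d) (Fin d) ℝ) (v w : E d) :
    modes U (v + w) = modes U v + modes U w := by
  simp [modes, Matrix.mulVec_add]

theorem modes_sub (U : Matrix (Fin d) (Fin d) ℝ) (v w : E d) :
    modes U (v - w) = modes U v - modes U w := by
  simp [modes, Matrix.mulVec_sub]

theorem modes_smul (U : Matrix (Fin d) (Fin d) ℝ) (c : ℝ) (v : E d) :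
    modes U (c • v) = c • modes U v := by
  simp [modes, Matrix.mulVec_smul]

theorem sum_modes_sq {U : Matrix (Fin d) (Fin d) ℝ} (hU : U ∈ Matrix.orthogonalGroup (Fin d) ℝ)
    (v : E d) : ∑ i, modes U v i ^ 2 = ‖v‖ ^ 2 := by
  have h1 : ∑ i, modes U v i ^ 2 = modes U v ⬝ᵥ modes U v := by
    simp [dotProduct, pow_two]
  rw [h1, modes, Matrix.dotProduct_mulVec, Matrix.vecMul_transpose, Matrix.mulVec_mulVec,
    mul_transpose_self_of_orthogonal hU, Matrix.one_mulVec, EuclideanSpace.norm_sq_eq]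
  simp [dotProduct, pow_two]

theorem modes_mulVec {U : Matrix (Fin d) (Fin d) ℝ} (hU : U ∈ Matrix.orthogonalGroup (Fin d) ℝ)
    (lam : Fin d → ℝ) (v : E d) (i : Fin d) :
    modes U (WithLp.toLp 2 ((U * Matrix.diagonal lam * Uᵀ) *ᵥ v.ofLp)) i = lam i * modes U v i := by
  rw [modes, modes, Matrix.mulVec_mulVec, ← Matrix.mul_assoc, ← Matrix.mul_assoc,
    transpose_mul_self_of_orthogonal hU, Matrix.one_mul, ← Matrix.mulVec_mulVec,
    Matrix.mulVec_diagonal]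

theorem dotProduct_mulVec_eq_sum_modes (U : Matrix (Fin d) (Fin d) ℝ) (lam : Fin d → ℝ) (v : E d) :
    v.ofLp ⬝ᵥ (U * Matrix.diagonal lam * Uᵀ) *ᵥ v.ofLp = ∑ i, lam i * modes U v i ^ 2 := by
  rw [← Matrix.mulVec_mulVec, ← Matrix.mulVec_mulVec, Matrix.dotProduct_mulVec,
    ← Matrix.mulVec_transpose]
  simp only [dotProduct, Matrix.mulVec_diagonal, modes]
  exact Finset.sum_congr rfl fun i _ => by ring

/-! ### Upper bound on the gain -/

/-- The one-step inequality telescopes; the final storage is dropped and the initial one serves as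
`H`. -/
theorem hasGainLE_of_storage {f : E d → ℝ} {xstar : E d} {α β ν : ℝ} (S : Set (State d)) {γ : ℝ≥0}
    (hmin : ∀ x, f xstar ≤ f x) (V : State d → ℝ) (hV0 : V (xstar, xstar) = 0)
    (hV : ∀ ξ, 0 ≤ V ξ)
    (hstep : ∀ ξ w, f ξ.1 - f xstar ≤ (γ : ℝ) ^ 2 * ‖w‖ ^ 2 + V ξ - V (step f α β ν w ξ)) :
    HasGainLE f xstar α β ν S γ := by
  refine ⟨fun ξ => (V ξ).toNNReal, by simp [hV0], fun ξ₀ _ w _ => ?_⟩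
  refine ENNReal.tsum_le_of_sum_range_le fun n => ?_
  have h : ∑ k ∈ Finset.range n, (f (iterate f α β ν w ξ₀ k) - f xstar) ≤
      (γ : ℝ) ^ 2 * ∑ k ∈ Finset.range n, ‖w k‖ ^ 2 + V ξ₀ - V (state f α β ν w ξ₀ n) := by
    induction n with
    | zero => simp [state]
    | succ n ih =>
      have := hstep (state f α β ν w ξ₀ n) (w n)
      rw [Finset.sum_range_succ, Finset.sum_range_succ, mul_add, state, iterate]
      linarith
  rw [← ENNReal.ofReal_sum_of_nonneg fun k _ => sub_nonneg.2 (hmin _)]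
  calc _ ≤ ENNReal.ofReal ((γ : ℝ) ^ 2 * ∑ k ∈ Finset.range n, ‖w k‖ ^ 2 + V ξ₀) :=
        ENNReal.ofReal_le_ofReal (by linarith [hV (state f α β ν w ξ₀ n)])
    _ = (γ : ℝ≥0∞) ^ 2 * ∑ k ∈ Finset.range n, ENNReal.ofReal (‖w k‖ ^ 2) +
        ((V ξ₀).toNNReal : ℝ≥0∞) := by
        rw [ENNReal.ofReal_add (by positivity) (hV _), ENNReal.ofReal_mul (by positivity),
          ENNReal.ofReal_sum_of_nonneg fun k _ => by positivity, ENNReal.ofReal_pow γ.coe_nonneg,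
          ENNReal.ofReal_coe_nnreal]
        rfl
    _ ≤ _ := by
        gcongr
        exact ENNReal.sum_le_tsum _

theorem l2Gain_heavyBall_le {U : Matrix (Fin d) (Fin d) ℝ}
    (hU : U ∈ Matrix.orthogonalGroup (Fin d) ℝ) {lam : Fin d → ℝ} {p : Fin d → ℝ} {r : ℝ}
    (hQ : (U * Matrix.diagonal lam * Uᵀ).IsHermitian) {xstar : E d}
    (hmin : ∀ x, quadratic (U * Matrix.diagonal lam * Uᵀ) p r xstar ≤
      quadratic (U * Matrix.diagonal lam * Uᵀ) p r x) (S : Set (State d))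
    {α b μ : ℝ} (hα : 0 < α) (hμ : 0 < μ) (hb0 : 0 < b) (hb1 : b < 1) (hαμ : α * μ = (1 - b) ^ 2)
    (h0 : ∀ i, μ ≤ lam i) (h1 : ∀ i, α * lam i ≤ 1 + b ^ 2) :
    l2Gain (quadratic (U * Matrix.diagonal lam * Uᵀ) p r) xstar α (b ^ 2) 0 S ≤
      ENNReal.ofReal (1 / √(2 * μ)) := by
  choose A B C hnn hdiss using fun i => exists_storage (x := α * lam i) hb0 hb1
    (hαμ ▸ mul_le_mul_of_nonneg_left (h0 i) hα.le) (h1 i)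
  let W : State d → ℝ := fun ξ => ∑ i, (A i * modes U (ξ.1 - xstar) i ^ 2 +
    B i * modes U (ξ.1 - xstar) i * modes U (ξ.2 - xstar) i + C i * modes U (ξ.2 - xstar) i ^ 2)
  -- The modal input is `-α` times the error and the supply subtracts `αλ · αμ` times the squared
  -- position. Division by `2α²μ` normalizes these to `1/(2μ)` and `λ/2`.
  have hc : 0 < 2 * α ^ 2 * μ := by positivity
  refine iInf₂_le (Real.toNNReal (1 / √(2 * μ))) ?_
  refine hasGainLE_of_storage S hmin (fun ξ => W ξ / (2 * α ^ 2 * μ)) ?_ ?_ ?_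
  · simp [W, modes]
  · exact fun ξ => div_nonneg (Finset.sum_nonneg fun i _ => hnn i _ _) hc.le
  intro ξ w
  have hγ : ((Real.toNNReal (1 / √(2 * μ)) : ℝ≥0) : ℝ) ^ 2 = 1 / (2 * μ) := by
    rw [Real.coe_toNNReal _ (by positivity), div_pow, Real.sq_sqrt (by positivity), one_pow]
  rw [hγ]
  set ξ' := step (quadratic (U * Matrix.diagonal lam * Uᵀ) p r) α (b ^ 2) 0 w ξ with hξ'
  have hrec : ∀ i, modes U (ξ'.1 - xstar) i - (1 + b ^ 2 - α * lam i) * modes U (ξ.1 - xstar) i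
      + b ^ 2 * modes U (ξ.2 - xstar) i = -(α * modes U w i) := by
    intro i
    have e : ξ'.1 - xstar = (ξ.1 - xstar) - α • (WithLp.toLp 2
        ((U * Matrix.diagonal lam * Uᵀ) *ᵥ (ξ.1 - xstar).ofLp) + w) +
        b ^ 2 • ((ξ.1 - xstar) - (ξ.2 - xstar)) := by
      rw [hξ', step, gradient_quadratic_of_minimizer hQ hmin]
      simp only [zero_smul, add_zero, sub_sub_sub_cancel_right]
      abel
    rw [e]
    simp only [modes_add, modes_sub U (_ - _), modes_smul, Pi.add_apply,
      Pi.sub_apply, Pi.smul_apply, smul_eq_mul, modes_mulVec hU]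
    ring
  have hsum : W ξ' - W ξ ≤ α ^ 2 * ‖w‖ ^ 2 - α * (1 - b) ^ 2 *
      ∑ i, lam i * modes U (ξ.1 - xstar) i ^ 2 := by
    rw [← sum_modes_sq hU w, Finset.mul_sum, Finset.mul_sum, ← Finset.sum_sub_distrib,
      ← Finset.sum_sub_distrib]
    refine Finset.sum_le_sum fun i _ => ?_
    have h2 : ξ'.2 = ξ.1 := rfl
    have := hdiss i (modes U (ξ'.1 - xstar) i) (modes U (ξ.1 - xstar) i) (modes U (ξ.2 - xstar) i)
    rw [hrec i] at this
    rw [h2]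
    linarith
  rw [quadratic_sub_of_minimizer hQ hmin, dotProduct_mulVec_eq_sum_modes]
  rw [← hαμ] at hsum
  generalize ∑ i, lam i * modes U (ξ.1 - xstar) i ^ 2 = s at hsum ⊢
  refine le_of_mul_le_mul_left ?_ hc
  have e : 2 * α ^ 2 * μ * (1 / (2 * μ) * ‖w‖ ^ 2 + W ξ / (2 * α ^ 2 * μ)
      - W ξ' / (2 * α ^ 2 * μ)) = α ^ 2 * ‖w‖ ^ 2 + W ξ - W ξ' := by
    field_simp
  rw [e]
  linarith

/-! ### Lower bound on the gain -/

/-- The signal that is `1` for `2 ≤ j < n + 4` and `0` elsewhere. -/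
def pulse (n j : ℕ) : ℝ := if 2 ≤ j ∧ j < n + 4 then 1 else 0

theorem abs_pulse_le (n j : ℕ) : |pulse n j| ≤ 1 := by
  rw [pulse]; split_ifs <;> simp

/-- Along an eigenvector any trajectory can be prescribed: the recursion is solved for the error.
The pulse vanishes at `0` and `1`, which encode `x_{-1}` and `x_0`, so the start is `(x_*, x_*)`, a
state of both classes. -/
theorem state_pulse {f : E d → ℝ} {xstar v : E d} {α β ν μ : ℝ} (hα : 0 < α)
    (hgrad : ∀ t : ℝ, gradient f (xstar + t • v) = (t * μ) • v) (n k : ℕ) :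
    state f α β ν (fun k => (-(1 / α) * (pulse n (k + 2) -
        (1 + β - α * (1 + ν) * μ) * pulse n (k + 1) + (β - α * ν * μ) * pulse n k)) • v)
      (xstar, xstar) k = (xstar + pulse n (k + 1) • v, xstar + pulse n k • v) := by
  induction k with
  | zero => simp [state, pulse]
  | succ k ih =>
    rw [state, ih, step]
    have e : xstar + pulse n (k + 1) • v + ν • (xstar + pulse n (k + 1) • v
        - (xstar + pulse n k • v)) =
        xstar + (pulse n (k + 1) + ν * (pulse n (k + 1) - pulse n k)) • v := by
      module
    simp only [e, hgrad]
    refine Prod.ext ?_ rfl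
    simp only
    match_scalars <;> field_simp <;> ring

/-- The pulse errors are tested as `n → ∞`. They have finite support, since the iterate is steered
back to `x_*` and stays there, and `H` vanishes at the start. -/
theorem le_of_hasGainLE {f : E d → ℝ} {xstar v : E d} {α β ν μ : ℝ} (hα : 0 < α) (hμ : 0 < μ)
    (hv : ‖v‖ = 1) (hgrad : ∀ t : ℝ, gradient f (xstar + t • v) = (t * μ) • v)
    (hval : ∀ t : ℝ, f (xstar + t • v) - f xstar = μ / 2 * t ^ 2) {S : Set (State d)}
    (hS : (xstar, xstar) ∈ S) {γ : ℝ≥0} (h : HasGainLE f xstar α β ν S γ) :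
    1 / √(2 * μ) ≤ γ := by
  obtain ⟨H, hH, hgain⟩ := h
  obtain ⟨a, ha⟩ : ∃ a, a = 1 + β - α * (1 + ν) * μ := ⟨_, rfl⟩
  obtain ⟨c, hc⟩ : ∃ c, c = β - α * ν * μ := ⟨_, rfl⟩
  obtain ⟨K, hK⟩ : ∃ K, K = (1 / α * (1 + |a| + |c|)) ^ 2 := ⟨_, rfl⟩
  have main : ∀ n : ℕ, n * (μ / 2) ≤ (γ : ℝ) ^ 2 * (n * μ ^ 2 + 4 * K) := by
    intro n
    obtain ⟨w, hw⟩ : ∃ w : ℕ → E d, w = fun k => (-(1 / α) * (pulse n (k + 2) -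
        (1 + β - α * (1 + ν) * μ) * pulse n (k + 1) + (β - α * ν * μ) * pulse n k)) • v :=
      ⟨_, rfl⟩
    have hnorm : ∀ k, ‖w k‖ ^ 2 =
        (1 / α * (pulse n (k + 2) - a * pulse n (k + 1) + c * pulse n k)) ^ 2 := by
      intro k
      rw [hw, ha, hc]
      simp only [norm_smul, hv, mul_one, Real.norm_eq_abs, sq_abs]
      ring
    have hzero : ∀ k ∉ Finset.range (n + 4), ‖w k‖ ^ 2 = 0 := by
      intro k hk
      rw [Finset.mem_range, not_lt] at hk
      rw [hnorm, pulse, pulse, pulse, if_neg (by omega), if_neg (by omega), if_neg (by omega)]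
      simp
    have hbound : ∀ k, ‖w k‖ ^ 2 ≤ K := by
      intro k
      rw [hnorm, hK, mul_pow, mul_pow]
      refine mul_le_mul_of_nonneg_left (sq_le_sq' ?_ ?_) (by positivity)
      all_goals
        have h0 := abs_le.1 (abs_pulse_le n (k + 2))
        have h1 := abs_le.1 ((abs_mul a (pulse n (k + 1))).trans_le
          (mul_le_of_le_one_right (abs_nonneg a) (abs_pulse_le n (k + 1))))
        have h2 := abs_le.1 ((abs_mul c (pulse n k)).trans_le
          (mul_le_of_le_one_right (abs_nonneg c) (abs_pulse_le n k)))
        linarith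
    -- Here all three pulse values are `1` and the error just cancels the gradient `μ v`. Only the
    -- two steps at each end differ, which gives the `4 * K` below.
    have hbulk : ∀ k < n, ‖w (k + 1 + 1)‖ ^ 2 = μ ^ 2 := by
      intro k hk
      rw [hnorm, pulse, pulse, pulse, if_pos (by omega), if_pos (by omega), if_pos (by omega), ha, hc]
      congr 1
      field_simp
      ring
    have hsum : ∑ k ∈ Finset.range (n + 4), ‖w k‖ ^ 2 ≤ n * μ ^ 2 + 4 * K := by
      rw [Finset.sum_range_succ, Finset.sum_range_succ, Finset.sum_range_succ',
        Finset.sum_range_succ', Finset.sum_congr rfl fun k hk => hbulk k (Finset.mem_range.1 hk)]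
      simp only [Finset.sum_const, Finset.card_range, nsmul_eq_mul]
      linarith [hbound 0, hbound (0 + 1), hbound (n + 2), hbound (n + 3)]
    have hg := hgain _ hS w (summable_of_ne_finset_zero hzero)
    have hK0 : 0 ≤ K := by rw [hK]; positivity
    rw [hH, ENNReal.coe_zero, add_zero,
      tsum_eq_sum (f := fun k => ENNReal.ofReal (‖w k‖ ^ 2)) (s := Finset.range (n + 4))
        (fun k hk => by rw [hzero k hk, ENNReal.ofReal_zero]),
      ← ENNReal.ofReal_sum_of_nonneg fun k _ => by positivity] at hg
    have hit : ∀ k, f (iterate f α β ν w (xstar, xstar) k) - f xstar =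
        μ / 2 * pulse n (k + 1) ^ 2 := by
      intro k
      rw [iterate, hw, state_pulse hα hgrad, hval]
    have hlow : ENNReal.ofReal (n * (μ / 2)) ≤
        ∑' k, ENNReal.ofReal (f (iterate f α β ν w (xstar, xstar) k) - f xstar) := by
      refine le_trans (le_trans ?_ (ENNReal.sum_le_tsum (Finset.range (n + 1)))) le_rfl
      rw [← ENNReal.ofReal_sum_of_nonneg fun k _ => by rw [hit]; positivity, Finset.sum_range_succ']
      refine ENNReal.ofReal_le_ofReal ?_
      have : ∀ k ∈ Finset.range n, f (iterate f α β ν w (xstar, xstar) (k + 1)) - f xstar =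
          μ / 2 := by
        intro k hk
        have := Finset.mem_range.1 hk
        rw [hit, pulse, if_pos (by omega), one_pow, mul_one]
      rw [Finset.sum_congr rfl this, hit]
      simp only [Finset.sum_const, Finset.card_range, nsmul_eq_mul]
      have : 0 ≤ μ / 2 * pulse n (0 + 1) ^ 2 := by positivity
      linarith
    have hfin := hlow.trans (hg.trans (mul_le_mul_right (ENNReal.ofReal_le_ofReal hsum) _))
    rw [← ENNReal.ofReal_coe_nnreal, ← ENNReal.ofReal_pow γ.coe_nonneg, ← ENNReal.ofReal_mul (by positivity),
      ENNReal.ofReal_le_ofReal_iff (by positivity)] at hfin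
    exact hfin
  have hγ : μ / 2 ≤ (γ : ℝ) ^ 2 * μ ^ 2 := by
    by_contra! hlt
    obtain ⟨n, hn⟩ := exists_nat_gt ((γ : ℝ) ^ 2 * (4 * K) / (μ / 2 - (γ : ℝ) ^ 2 * μ ^ 2))
    rw [div_lt_iff₀ (by linarith)] at hn
    have := main n
    linarith
  refine le_of_sq_le_sq ?_ γ.2
  rw [div_pow, Real.sq_sqrt (by positivity), one_pow, div_le_iff₀ (by positivity)]
  have : μ * (1 / 2) ≤ μ * ((γ : ℝ) ^ 2 * μ) := by linarith
  have := le_of_mul_le_mul_left this hμ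
  linarith

theorem le_l2Gain {U : Matrix (Fin d) (Fin d) ℝ}
    (hU : U ∈ Matrix.orthogonalGroup (Fin d) ℝ) {lam : Fin d → ℝ} {p : Fin d → ℝ} {r : ℝ}
    (hQ : (U * Matrix.diagonal lam * Uᵀ).IsHermitian) {xstar : E d}
    (hmin : ∀ x, quadratic (U * Matrix.diagonal lam * Uᵀ) p r xstar ≤
      quadratic (U * Matrix.diagonal lam * Uᵀ) p r x) {S : Set (State d)}
    (hS : (xstar, xstar) ∈ S) {α : ℝ} (hα : 0 < α) (β ν : ℝ) {i : Fin d} (hi : 0 < lam i) :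
    ENNReal.ofReal (1 / √(2 * lam i)) ≤
      l2Gain (quadratic (U * Matrix.diagonal lam * Uᵀ) p r) xstar α β ν S := by
  refine le_iInf₂ fun γ h => ?_
  rw [← ENNReal.ofReal_coe_nnreal]
  refine ENNReal.ofReal_le_ofReal ?_
  have hm : modes U (WithLp.toLp 2 (U *ᵥ Pi.single i 1)) = Pi.single i 1 := by
    simp only [modes, Matrix.mulVec_mulVec, transpose_mul_self_of_orthogonal hU, Matrix.one_mulVec]
  refine le_of_hasGainLE (v := WithLp.toLp 2 (U *ᵥ Pi.single i 1)) hα hi ?_ ?_ ?_ hS h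
  · have := sum_modes_sq hU (WithLp.toLp 2 (U *ᵥ Pi.single i 1))
    rw [hm, Finset.sum_eq_single i (fun j _ hj => by simp [hj]) (by simp)] at this
    simp only [Pi.single_eq_same, one_pow] at this
    exact (sq_eq_sq₀ (norm_nonneg _) zero_le_one).1 (by rw [← this, one_pow])
  · intro t
    rw [gradient_quadratic_of_minimizer hQ hmin, add_sub_cancel_left]
    have : (U * Matrix.diagonal lam * Uᵀ) *ᵥ (U *ᵥ Pi.single i 1) = lam i • (U *ᵥ Pi.single i 1) := by
      rw [Matrix.mulVec_mulVec, Matrix.mul_assoc, transpose_mul_self_of_orthogonal hU,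
        Matrix.mul_one, ← Matrix.mulVec_mulVec, ← Matrix.mulVec_smul]
      congr 1
      ext j
      rw [Matrix.mulVec_diagonal]
      rcases eq_or_ne j i with rfl | hj
      · simp
      · simp [hj]
    rw [WithLp.ofLp_smul, Matrix.mulVec_smul, this, smul_smul, WithLp.toLp_smul]
  · intro t
    rw [quadratic_sub_of_minimizer hQ hmin, add_sub_cancel_left, dotProduct_mulVec_eq_sum_modes,
      modes_smul, hm, Finset.sum_eq_single i (fun j _ hj => by simp [hj]) (by simp)]
    simp
    ring

end GMM

theorem mainTheorem2 :
    -- the method on quadratics whose Hessian has extreme eigenvalues `μ < L`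
    (∀ (d : ℕ) (Q : Matrix (Fin d) (Fin d) ℝ) (p : Fin d → ℝ) (r μ L : ℝ)
        (f : GMM.E d → ℝ) (xstar : GMM.E d) (κ α β : ℝ),
      Q.PosDef → IsLeast (spectrum ℝ Q) μ → IsGreatest (spectrum ℝ Q) L → μ < L →
      f = GMM.quadratic Q p r → (∀ x, f xstar ≤ f x) →
      κ = L / μ → α = GMM.rsA κ ^ 2 / L → β = (1 - GMM.rsA κ / Real.sqrt κ) ^ 2 →
      -- the rate, which is in `(0, 1)`
      (0 < 1 - GMM.rsA κ / Real.sqrt κ ∧ 1 - GMM.rsA κ / Real.sqrt κ < 1 ∧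
        GMM.rate Q α β 0 = ENNReal.ofReal (1 - GMM.rsA κ / Real.sqrt κ)) ∧
      -- the `ℓ₂` gain, over all initial states and over those with `x_{-1} = x_0`
      GMM.l2Gain f xstar α β 0 Set.univ = ENNReal.ofReal (1 / Real.sqrt (2 * μ)) ∧
      GMM.l2Gain f xstar α β 0 (GMM.restStates d) = ENNReal.ofReal (1 / Real.sqrt (2 * μ)) ∧
      -- the `H_∞` norm
      (∀ U ∈ Matrix.orthogonalGroup (Fin d) ℝ, ∀ lam : Fin d → ℝ,
        Q = U * Matrix.diagonal lam * Uᵀ →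
        GMM.hInf U lam α β 0 = ENNReal.ofReal (1 / Real.sqrt (2 * μ))) ∧
      -- this level is the best possible one among the convergent momentum methods
      (∀ α' β' ν' : ℝ, 0 < α' → 0 ≤ β' → 0 ≤ ν' → GMM.rate Q α' β' ν' < 1 →
        ENNReal.ofReal (1 / Real.sqrt (2 * μ)) ≤ GMM.l2Gain f xstar α' β' ν' Set.univ ∧
        ENNReal.ofReal (1 / Real.sqrt (2 * μ)) ≤
          GMM.l2Gain f xstar α' β' ν' (GMM.restStates d) ∧
        ∀ U ∈ Matrix.orthogonalGroup (Fin d) ℝ, ∀ lam : Fin d → ℝ,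
          Q = U * Matrix.diagonal lam * Uᵀ →
          ENNReal.ofReal (1 / Real.sqrt (2 * μ)) ≤ GMM.hInf U lam α' β' ν')) ∧
    -- the function `a`
    MonotoneOn GMM.rsA (Set.Ioi 1) ∧
    (∀ κ : ℝ, 32 ≤ κ → 5 / 4 < GMM.rsA κ) ∧
    (fun κ : ℝ => GMM.rsA κ - (Real.sqrt 2 - 1 / Real.sqrt κ)) =O[atTop] (fun κ : ℝ => 1 / κ) ∧
    (fun κ : ℝ => (1 - GMM.rsA κ / Real.sqrt κ) - (1 - Real.sqrt 2 / Real.sqrt κ))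
      =O[atTop] (fun κ : ℝ => 1 / κ) := by
  refine ⟨?_, GMM.monotoneOn_rsA, fun κ h => GMM.five_quarters_lt_rsA h, GMM.isBigO_rsA,
    GMM.isBigO_rsA_rate⟩
  intro d Q p r μ L f xstar κ α β hQ hleast hgreatest hμL hf hmin hκ hα hβ
  have hrange : ∀ U ∈ Matrix.orthogonalGroup (Fin d) ℝ, ∀ lam : Fin d → ℝ,
      Q = U * Matrix.diagonal lam * Uᵀ → (∀ i, μ ≤ lam i) ∧ (∀ i, lam i ≤ L) ∧ ∃ i, lam i = μ := by
    intro U hU lam h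
    rw [h, GMM.spectrum_orthogonal_conj hU] at hleast hgreatest
    exact ⟨fun i => hleast.2 ⟨i, rfl⟩, fun i => hgreatest.2 ⟨i, rfl⟩, hleast.1⟩
  have hμ : 0 < μ := by
    have := hleast.1
    rw [hQ.isHermitian.spectrum_real_eq_range_eigenvalues] at this
    obtain ⟨i, rfl⟩ := this
    exact hQ.eigenvalues_pos i
  have hL : 0 < L := hμ.trans hμL
  have hκ1 : 1 < κ := by rwa [hκ, one_lt_div hμ]
  have ha := GMM.rsA_pos hκ1
  have hs0 : 0 < GMM.rsA κ / √κ := div_pos ha (Real.sqrt_pos.2 (by linarith))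
  have hs1 := GMM.rsA_div_sqrt_lt_one hκ1
  have hα0 : 0 < α := by rw [hα]; positivity
  -- This and `hαμ` are all that the upper bounds and the rate need from the choice of `a`, besides
  -- `0 < b < 1`.
  have hαL : α * L ≤ 1 + (1 - GMM.rsA κ / √κ) ^ 2 := by
    rw [hα, div_mul_cancel₀ _ hL.ne']
    exact GMM.rsA_sq_le κ
  have hαμ : α * μ = (1 - (1 - GMM.rsA κ / √κ)) ^ 2 := by
    rw [sub_sub_cancel, div_pow, Real.sq_sqrt (by linarith), hα, hκ]
    field_simp
  have hb0 : 0 < 1 - GMM.rsA κ / √κ := by linarith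
  have hb1 : 1 - GMM.rsA κ / √κ < 1 := by linarith
  generalize 1 - GMM.rsA κ / √κ = b at *
  subst hβ hf
  have hupper : ∀ lam : Fin d → ℝ, (∀ i, lam i ≤ L) → ∀ i, α * lam i ≤ 1 + b ^ 2 :=
    fun lam h i => (mul_le_mul_of_nonneg_left (h i) hα0.le).trans hαL
  have hlower : ∀ lam : Fin d → ℝ, (∀ i, μ ≤ lam i) → ∀ i, (1 - b) ^ 2 ≤ α * lam i :=
    fun lam h i => hαμ ▸ mul_le_mul_of_nonneg_left (h i) hα0.le
  have hrest : (xstar, xstar) ∈ GMM.restStates d := rfl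
  have hH : ∀ U ∈ Matrix.orthogonalGroup (Fin d) ℝ, ∀ lam : Fin d → ℝ,
      Q = U * Matrix.diagonal lam * Uᵀ → ∀ α' β' ν' : ℝ, 0 < α' →
      ENNReal.ofReal (1 / √(2 * μ)) ≤ GMM.hInf U lam α' β' ν' := by
    intro U hU lam h α' β' ν' hα'
    obtain ⟨h0, -, i, rfl⟩ := hrange U hU lam h
    exact GMM.le_hInf hU (fun j => hμ.trans_le (h0 j)) hα' β' ν' i
  have hHle : ∀ U ∈ Matrix.orthogonalGroup (Fin d) ℝ, ∀ lam : Fin d → ℝ,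
      Q = U * Matrix.diagonal lam * Uᵀ →
      GMM.hInf U lam α (b ^ 2) 0 ≤ ENNReal.ofReal (1 / √(2 * μ)) := by
    intro U hU lam h
    obtain ⟨h0, h1, -⟩ := hrange U hU lam h
    exact GMM.hInf_heavyBall_le hU (fun j => hμ.trans_le (h0 j)) hα0 hμ hb0 hb1 hαμ h0
      (hupper lam h1)
  obtain ⟨U, hU, lam, hdiag⟩ := GMM.exists_orthogonal_diagonalization hQ.isHermitian
  obtain ⟨h0, h1, i₀, hi₀⟩ := hrange U hU lam hdiag
  have hherm := hQ.isHermitian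
  rw [hdiag] at hherm
  have hG : ∀ S : Set (GMM.State d), (xstar, xstar) ∈ S → ∀ α' β' ν' : ℝ, 0 < α' →
      ENNReal.ofReal (1 / √(2 * μ)) ≤
        GMM.l2Gain (GMM.quadratic Q p r) xstar α' β' ν' S := by
    intro S hS α' β' ν' hα'
    rw [hdiag] at hmin ⊢
    rw [← hi₀]
    exact GMM.le_l2Gain hU hherm hmin hS hα' β' ν' (hi₀ ▸ hμ)
  have hGle : ∀ S : Set (GMM.State d), GMM.l2Gain (GMM.quadratic Q p r) xstar α (b ^ 2) 0 S ≤
      ENNReal.ofReal (1 / √(2 * μ)) := by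
    intro S
    rw [hdiag] at hmin ⊢
    exact GMM.l2Gain_heavyBall_le hU hherm hmin S hα0 hμ hb0 hb1 hαμ h0 (hupper lam h1)
  refine ⟨⟨hb0, hb1, ?_⟩, le_antisymm (hGle _) (hG _ (Set.mem_univ _) _ _ _ hα0),
    le_antisymm (hGle _) (hG _ hrest _ _ _ hα0),
    fun V hV l h => le_antisymm (hHle V hV l h) (hH V hV l h _ _ _ hα0),
    fun α' β' ν' hα' _ _ _ => ⟨hG _ (Set.mem_univ _) _ _ _ hα', hG _ hrest _ _ _ hα',
      fun V hV l h => hH V hV l h _ _ _ hα'⟩⟩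
  rw [hdiag]
  exact GMM.rate_heavyBall hU hb0 (by rw [hi₀, hαμ]) (hlower lam h0) (hupper lam h1)
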